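/- For a prime $p$ and integers $b, c$, let $D_p(b,c)$ denote the integer determinant $$D_p(b,c)=\det\left[(i^2+bij+cj^2)^{p-2}\right]_{1\le i,j\le p-1},$$ and let $\left(\frac{\cdot}{p}\right)$ denote the Legendre symbol modulo an odd prime $p$. Let $p$ be a prime with $p\equiv 1\pmod 4$. Then for every $b\in\mathbb{Z}$ with $\left(\frac{b^2+4}{p}\right)=-1$, we have $$\left(\frac{D_p(b,-1)}{p}\right)=\left(\frac{b}{p}\right).$$ -/

import Mathlib

/-- The integer determinant `D_p(b,c) = det [(i² + b i j + c j²)^(p-2)]` with `1 ≤ i, j ≤ p - 1`.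
The indices of `Fin (p - 1)` start at `0`, hence the shift by one. -/
def sunDet (p : ℕ) (b c : ℤ) : ℤ :=
  Matrix.det (Matrix.of fun i j : Fin (p - 1) =>
    ((((i : ℕ) : ℤ) + 1) ^ 2 + b * (((i : ℕ) : ℤ) + 1) * (((j : ℕ) : ℤ) + 1)
      + c * (((j : ℕ) : ℤ) + 1) ^ 2) ^ (p - 2))

/-! ### Diagonalising the matrix modulo `p`. -/

section PowerMoments

variable {p : ℕ} [Fact p.Prime]

/-! Modulo `p` the entries are inverses of a form without nontrivial zeros. By homogeneity, a
Vandermonde factor reduces the determinant to the product of the moments `S_k`, `1 ≤ k ≤ p - 1`,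
times a nonzero square (`det_inv_quadratic_form`). If `α` and `β = α ^ p` are the roots of `X ^ 2 +
b X - 1`, then `(b ^ 2 + 4) S_k = -(α ^ k + β ^ k)` (`powerMoment_formula`). As `α β = -1`, `S_k`
and `S_(p+1-k)` agree up to sign, and `-1` is a square, so only `k = 1` and `k = (p + 1) / 2`
matter. They contribute `-χ(b)` and `-1`. -/

/-- The power moments `∑ t, t ^ k / (t ^ 2 + b t - 1)` over the prime field. -/
noncomputable def powerMoment (b : ZMod p) (k : ℕ) : ZMod p :=
  ∑ t : ZMod p, t ^ k * (t ^ 2 + b * t - 1)⁻¹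

theorem sum_fin_succ_cast {M : Type*} [AddCommMonoid M] (F : ZMod p → M) (h0 : F 0 = 0) :
    ∑ i : Fin (p - 1), F ((i : ℕ) + 1) = ∑ t : ZMod p, F t := by
  have hp : p - 1 + 1 = p := Nat.sub_add_cancel (Fact.out : p.Prime).one_le
  have h1 : ∑ t : ZMod p, F t = ∑ i ∈ Finset.range p, F (i : ZMod p) := by
    refine Finset.sum_nbij' (fun t => t.val) (fun i => (i : ZMod p)) ?_ ?_ ?_ ?_ ?_
    · intro t _
      exact Finset.mem_range.2 (ZMod.val_lt t)
    · intro i _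
      exact Finset.mem_univ _
    · intro t _
      exact ZMod.natCast_zmod_val t
    · intro i hi
      exact ZMod.val_cast_of_lt (Finset.mem_range.1 hi)
    · intro t _
      rw [ZMod.natCast_zmod_val]
  have h2 : ∑ i ∈ Finset.range p, F (i : ZMod p) =
      ∑ i ∈ Finset.range (p - 1), F (((i + 1 : ℕ)) : ZMod p) + F ((0 : ℕ) : ZMod p) := by
    rw [← Finset.sum_range_succ' (fun i : ℕ => F (i : ZMod p)) (p - 1)]
    exact congrArg (fun n => ∑ i ∈ Finset.range n, F (i : ZMod p)) hp.symm
  rw [h1, h2]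
  simp only [Nat.cast_zero, h0, add_zero, Nat.cast_add, Nat.cast_one]
  exact Fin.sum_univ_eq_sum_range (fun i => F ((i : ZMod p) + 1)) (p - 1)

theorem natCast_fin_succ_ne_zero (i : Fin (p - 1)) : ((i : ℕ) : ZMod p) + 1 ≠ 0 := by
  intro h
  have h' : (((i : ℕ) + 1 : ℕ) : ZMod p) = 0 := by exact_mod_cast h
  rw [ZMod.natCast_eq_zero_iff] at h'
  have := Nat.le_of_dvd (Nat.succ_pos _) h'
  have := i.2
  omega

theorem natCast_fin_succ_injective :
    Function.Injective fun i : Fin (p - 1) => ((i : ℕ) : ZMod p) + 1 := by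
  intro i j h
  have h' : ((i : ℕ) : ZMod p) = ((j : ℕ) : ZMod p) := add_right_cancel h
  have hi : (i : ℕ) < p := by have := i.2; omega
  have hj : (j : ℕ) < p := by have := j.2; omega
  rw [ZMod.natCast_eq_natCast_iff', Nat.mod_eq_of_lt hi, Nat.mod_eq_of_lt hj] at h'
  exact Fin.ext h'

/-- Multiplying on the left by a Vandermonde matrix diagonalises the matrix
`[(i ^ 2 + b i j - j ^ 2)⁻¹]` up to column scaling. -/
theorem det_inv_quadratic_form (b : ZMod p) :
    (Matrix.of fun i j : Fin (p - 1) =>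
      ((((i : ℕ) : ZMod p) + 1) ^ 2 + b * (((i : ℕ) : ZMod p) + 1) * (((j : ℕ) : ZMod p) + 1)
        - (((j : ℕ) : ZMod p) + 1) ^ 2)⁻¹).det =
      (∏ k : Fin (p - 1), powerMoment b ((k : ℕ) + 1)) *
        (∏ j : Fin (p - 1), (((j : ℕ) : ZMod p) + 1)⁻¹) ^ 2 := by
  set x : Fin (p - 1) → ZMod p := fun i => ((i : ℕ) : ZMod p) + 1 with hx
  have hx0 : ∀ i, x i ≠ 0 := natCast_fin_succ_ne_zero
  set M : Matrix (Fin (p - 1)) (Fin (p - 1)) (ZMod p) :=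
    Matrix.of fun i j => (x i ^ 2 + b * x i * x j - x j ^ 2)⁻¹ with hM
  set A : Matrix (Fin (p - 1)) (Fin (p - 1)) (ZMod p) :=
    Matrix.of fun k i => x i ^ ((k : ℕ) + 1) with hA
  have hdetA : A.det ≠ 0 := by
    have h : A = (Matrix.vandermonde x).transpose * Matrix.diagonal x := by
      ext k i
      simp [hA, Matrix.mul_diagonal, Matrix.vandermonde_apply, pow_succ]
    rw [h, Matrix.det_mul, Matrix.det_transpose, Matrix.det_diagonal]
    exact mul_ne_zero (Matrix.det_vandermonde_ne_zero_iff.2 natCast_fin_succ_injective)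
      (Finset.prod_ne_zero_iff.2 fun i _ => hx0 i)
  have key : A * M = Matrix.diagonal (fun k : Fin (p - 1) => powerMoment b ((k : ℕ) + 1)) *
      (A * Matrix.diagonal fun j => (x j)⁻¹ ^ 2) := by
    ext k j
    rw [Matrix.diagonal_mul, Matrix.mul_diagonal, Matrix.mul_apply]
    simp only [hA, hM, Matrix.of_apply]
    -- The exponent is at least 1, so the term `t = 0` vanishes.
    have h1 := sum_fin_succ_cast (p := p)
      (fun t => t ^ ((k : ℕ) + 1) * (t ^ 2 + b * t * x j - x j ^ 2)⁻¹) (by simp)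
    refine h1.trans ?_
    rw [← Equiv.sum_comp (Equiv.mulRight₀ (x j) (hx0 j)), powerMoment, Finset.sum_mul]
    refine Finset.sum_congr rfl fun t _ => ?_
    have h2 : (t * x j) ^ 2 + b * (t * x j) * x j - x j ^ 2 = (t ^ 2 + b * t - 1) * x j ^ 2 := by
      ring
    change (t * x j) ^ ((k : ℕ) + 1) * ((t * x j) ^ 2 + b * (t * x j) * x j - x j ^ 2)⁻¹ = _
    rw [h2, mul_inv, mul_pow, inv_pow]
    ring
  have hdet := congrArg Matrix.det key
  rw [Matrix.det_mul, Matrix.det_mul, Matrix.det_mul, Matrix.det_diagonal, Matrix.det_diagonal,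
    Finset.prod_pow] at hdet
  apply mul_left_cancel₀ hdetA
  rw [hdet]
  ring

/-! ### Closed form of the moments. -/

theorem sum_prime_field_pow_eq_zero {K : Type*} [Field K] [Algebra (ZMod p) K] {k : ℕ}
    (hk : k < p - 1) : ∑ t : ZMod p, algebraMap (ZMod p) K t ^ k = 0 := by
  have h := FiniteField.sum_pow_lt_card_sub_one (ZMod p) k (by rwa [ZMod.card])
  have h' := congrArg (algebraMap (ZMod p) K) h
  simpa using h'

/-- For `k = 0` this is the logarithmic derivative of `X ^ p - X` at `α`, obtained here from a
geometric sum. Then `t ^ (k+1) / (t - α) = t ^ k + α t ^ k / (t - α)` gives the induction. -/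
theorem sum_pow_mul_inv_sub {K : Type*} [Field K] [Algebra (ZMod p) K] (α : K)
    (hα : ∀ t : ZMod p, algebraMap (ZMod p) K t ≠ α) {k : ℕ} (hk : k < p) :
    (α ^ p - α) * ∑ t : ZMod p, algebraMap (ZMod p) K t ^ k * (algebraMap (ZMod p) K t - α)⁻¹ =
      α ^ k := by
  have hp : 1 ≤ p := (Fact.out : p.Prime).one_le
  have hne : ∀ t : ZMod p, algebraMap (ZMod p) K t - α ≠ 0 := fun t => sub_ne_zero.2 (hα t)
  induction k with
  | succ k ih =>
    have h : ∑ t : ZMod p, algebraMap (ZMod p) K t ^ (k + 1) * (algebraMap (ZMod p) K t - α)⁻¹ =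
        ∑ t : ZMod p, algebraMap (ZMod p) K t ^ k +
        α * ∑ t : ZMod p, algebraMap (ZMod p) K t ^ k * (algebraMap (ZMod p) K t - α)⁻¹ := by
      rw [Finset.mul_sum, ← Finset.sum_add_distrib]
      refine Finset.sum_congr rfl fun t _ => ?_
      have := hne t
      field_simp
      ring
    rw [h, sum_prime_field_pow_eq_zero (by omega), zero_add, mul_left_comm, ih (by omega), pow_succ']
  | zero =>
    have h1 : ∀ t : ZMod p, ∑ i ∈ Finset.range p, algebraMap (ZMod p) K t ^ i * α ^ (p - 1 - i) =
        1 - (α ^ p - α) * (algebraMap (ZMod p) K t - α)⁻¹ := by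
      intro t
      have h2 := geom_sum₂_mul (algebraMap (ZMod p) K t) α p
      rw [← map_pow, ZMod.pow_card] at h2
      apply mul_right_cancel₀ (hne t)
      rw [h2]
      have := hne t
      field_simp
      ring
    have h3 := Finset.sum_congr (rfl : (Finset.univ : Finset (ZMod p)) = _) fun t _ => h1 t
    rw [Finset.sum_comm, Finset.sum_sub_distrib, ← Finset.mul_sum] at h3
    have h4 : ∑ i ∈ Finset.range p, ∑ t : ZMod p, algebraMap (ZMod p) K t ^ i * α ^ (p - 1 - i) =
        -1 := by
      rw [Finset.sum_eq_single (p - 1)]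
      · have h5 : ∑ t : ZMod p, t ^ (p - 1) = -1 := by
          have h : ∀ t : ZMod p, t ^ (p - 1) = 1 - if t = 0 then 1 else 0 := by
            intro t
            split_ifs with ht
            · have := (Fact.out : p.Prime).two_le
              rw [ht, zero_pow (by omega), sub_self]
            · rw [ZMod.pow_card_sub_one_eq_one ht, sub_zero]
          simp [h, Finset.sum_sub_distrib]
        rw [← Finset.sum_mul]
        simpa using congrArg (algebraMap (ZMod p) K) h5
      · intro i hi hi'
        rw [← Finset.sum_mul, sum_prime_field_pow_eq_zero, zero_mul]
        have := Finset.mem_range.1 hi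
        omega
      · intro h
        exact absurd (Finset.mem_range.2 (by omega)) h
    have h6 : ∑ _t : ZMod p, (1 : K) = 0 := by
      have := sum_prime_field_pow_eq_zero (p := p) (K := K) (k := 0)
        (by have := (Fact.out : p.Prime).two_le; omega)
      simpa using this
    rw [h4, h6] at h3
    simp only [pow_zero, one_mul]
    linear_combination h3

/-- An element outside the prime field whose minimal polynomial is `X ^ 2 + b X - 1`. -/
theorem exists_conjugate_roots (hp2 : p ≠ 2) (b : ZMod p) (hb : ¬ IsSquare (b ^ 2 + 4)) :
    ∃ α : AlgebraicClosure (ZMod p),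
      (∀ t : ZMod p, algebraMap (ZMod p) (AlgebraicClosure (ZMod p)) t ≠ α) ∧
      α + α ^ p = -algebraMap (ZMod p) (AlgebraicClosure (ZMod p)) b ∧ α * α ^ p = -1 ∧
      (α ^ p) ^ p = α := by
  set K := AlgebraicClosure (ZMod p)
  set φ := algebraMap (ZMod p) K
  obtain ⟨δ, hδ⟩ := IsAlgClosed.exists_pow_nat_eq (φ (b ^ 2 + 4)) (n := 2) (by norm_num)
  have h2p : (2 : ZMod p) ≠ 0 := by
    intro h
    have h' : ((2 : ℕ) : ZMod p) = 0 := by exact_mod_cast h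
    rw [ZMod.natCast_eq_zero_iff] at h'
    exact hp2 ((Nat.prime_dvd_prime_iff_eq Fact.out Nat.prime_two).1 h')
  have h2 : (2 : K) ≠ 0 := by
    intro h
    apply h2p
    apply φ.injective
    rw [map_ofNat, h, map_zero]
  simp only [map_add, map_pow, map_ofNat] at hδ
  set α : K := (-φ b + δ) / 2
  have hroot : α ^ 2 + φ b * α - 1 = 0 := by
    have h2α : 2 * α = -φ b + δ := mul_div_cancel₀ _ h2
    apply mul_left_cancel₀ (mul_ne_zero h2 h2)
    linear_combination (2 * α + φ b + δ) * h2α + hδ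
  have hnot : ∀ t : ZMod p, φ t ≠ α := by
    intro t ht
    apply hb
    refine ⟨2 * t + b, ?_⟩
    apply φ.injective
    rw [← ht] at hroot
    simp only [map_add, map_pow, map_ofNat, map_mul]
    linear_combination -4 * hroot
  have hfix : α ^ p ≠ α := by
    intro h
    obtain ⟨n, hn⟩ := mem_bot_iff_intCast p K |>.1
      ((Subfield.mem_bot_iff_pow_eq_self K p).2 h)
    exact hnot n (by rw [map_intCast, hn])
  -- Frobenius fixes `b`, so it permutes the roots.
  have hroot' : (α ^ p) ^ 2 + φ b * α ^ p - 1 = 0 := by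
    have h := congrArg (frobenius K p) hroot
    simp only [map_add, map_sub, map_mul, map_pow, map_one, map_zero, frobenius_def] at h
    rwa [← map_pow φ, ZMod.pow_card] at h
  have hsum : α + α ^ p = -φ b := by
    apply mul_left_cancel₀ (sub_ne_zero.2 hfix)
    linear_combination hroot' - hroot
  refine ⟨α, hnot, hsum, by linear_combination α * hsum - hroot, ?_⟩
  have h := congrArg (frobenius K p) hsum
  simp only [map_add, map_neg, frobenius_def] at h
  rw [← map_pow φ, ZMod.pow_card] at h
  linear_combination h - hsum

/-- Partial fractions over the two roots, with `b ^ 2 + 4 = (α - β) ^ 2`. -/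
theorem powerMoment_formula (b : ZMod p) {K : Type*} [Field K] [Algebra (ZMod p) K] {α : K}
    (hα : ∀ t : ZMod p, algebraMap (ZMod p) K t ≠ α)
    (hsum : α + α ^ p = -algebraMap (ZMod p) K b) (hmul : α * α ^ p = -1)
    (hinv : (α ^ p) ^ p = α) {k : ℕ} (hk : k < p) :
    algebraMap (ZMod p) K ((b ^ 2 + 4) * powerMoment b k) = -(α ^ k + (α ^ p) ^ k) := by
  set φ := algebraMap (ZMod p) K
  set β := α ^ p with hβ
  have hβ' : ∀ t : ZMod p, φ t ≠ β := by
    intro t ht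
    apply hα t
    rw [← hinv, ← ht, ← map_pow, ZMod.pow_card]
  have h1 := sum_pow_mul_inv_sub α hα hk
  have h2 := sum_pow_mul_inv_sub β hβ' hk
  rw [hinv] at h2
  rw [← hβ] at h1
  have h3 : (α - β) * φ (powerMoment b k) =
      ∑ t : ZMod p, φ t ^ k * (φ t - α)⁻¹ - ∑ t : ZMod p, φ t ^ k * (φ t - β)⁻¹ := by
    rw [powerMoment, map_sum, Finset.mul_sum, ← Finset.sum_sub_distrib]
    refine Finset.sum_congr rfl fun t _ => ?_
    have e1 : φ t - α ≠ 0 := sub_ne_zero.2 (hα t)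
    have e2 : φ t - β ≠ 0 := sub_ne_zero.2 (hβ' t)
    have e3 : φ (t ^ 2 + b * t - 1) = (φ t - α) * (φ t - β) := by
      simp only [map_add, map_sub, map_mul, map_pow, map_one]
      linear_combination φ t * hsum - hmul
    rw [map_mul, map_inv₀, e3, map_pow]
    field_simp
    ring
  have h4 : φ (b ^ 2 + 4) = (α - β) ^ 2 := by
    simp only [map_add, map_pow, map_ofNat]
    linear_combination (φ b - (α + β)) * hsum + 4 * hmul
  rw [map_mul, h4]
  linear_combination (α - β) * h3 - h1 - h2

end PowerMoments

/-! ### Quadratic character of the product of moments. -/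

section Legendre

variable {p : ℕ} [Fact p.Prime] {b : ZMod p}

theorem powerMoment_reflect (hp2 : p ≠ 2) (hb : ¬ IsSquare (b ^ 2 + 4)) {k : ℕ}
    (hk : 2 ≤ k) (hk' : k < p) :
    powerMoment b (p + 1 - k) = (-1) ^ (k + 1) * powerMoment b k := by
  obtain ⟨α, hα, hsum, hmul, hinv⟩ := exists_conjugate_roots hp2 b hb
  have hδ : b ^ 2 + 4 ≠ 0 := fun h => hb (h ▸ IsSquare.zero)
  apply mul_left_cancel₀ hδ
  apply (algebraMap (ZMod p) (AlgebraicClosure (ZMod p))).injective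
  have h1 := powerMoment_formula b hα hsum hmul hinv hk'
  have h2 := powerMoment_formula b hα hsum hmul hinv (show p + 1 - k < p by omega)
  rw [h2, mul_left_comm, map_mul, h1]
  simp only [map_pow, map_neg, map_one]
  set β := α ^ p
  have hα0 : α ≠ 0 := by rintro h; simp [h] at hmul
  have hβ0 : β ≠ 0 := by rintro h; simp [h] at hmul
  have e1 : α ^ (p + 1 - k) = (-1) ^ (k + 1) * β ^ k := by
    apply mul_right_cancel₀ (pow_ne_zero k hα0)
    rw [← pow_add, Nat.sub_add_cancel (by omega), pow_succ, mul_comm, hmul, mul_assoc,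
      ← mul_pow, mul_comm β, hmul, pow_succ, mul_right_comm, ← mul_pow]
    simp
  have e2 : β ^ (p + 1 - k) = (-1) ^ (k + 1) * α ^ k := by
    apply mul_right_cancel₀ (pow_ne_zero k hβ0)
    rw [← pow_add, Nat.sub_add_cancel (by omega), pow_succ, hinv, hmul, mul_assoc,
      ← mul_pow, hmul, pow_succ, mul_right_comm, ← mul_pow]
    simp
  rw [e1, e2]
  ring

theorem powerMoment_ne_zero (hp : p % 4 = 1) (hb : ¬ IsSquare (b ^ 2 + 4)) {k : ℕ} (hk : k < p) :
    powerMoment b k ≠ 0 := by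
  intro h0
  have hp2 : p ≠ 2 := by omega
  obtain ⟨α, hα, hsum, hmul, hinv⟩ := exists_conjugate_roots hp2 b hb
  have h1 := powerMoment_formula b hα hsum hmul hinv hk
  rw [h0, mul_zero, map_zero] at h1
  obtain ⟨m, hm⟩ : ∃ m, p = 4 * m + 1 := ⟨p / 4, by omega⟩
  have hα0 : α ≠ 0 := by rintro h; simp [h] at hmul
  have hγ : (α ^ (p - 1)) ^ k = -1 := by
    apply mul_right_cancel₀ (pow_ne_zero k hα0)
    rw [← mul_pow, ← pow_succ, Nat.sub_add_cancel (by omega)]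
    linear_combination h1
  -- The exponent `(p + 1) / 2 = 2 * m + 1` is odd, so `-1` would equal `1`.
  have h2 : ((α ^ (p - 1)) ^ k) ^ (2 * m + 1) = 1 := by
    rw [← pow_mul, ← pow_mul, show (p - 1) * (k * (2 * m + 1)) = (p + 1) * (2 * (m * k)) by
      rw [hm]; simp only [Nat.add_sub_cancel]; ring, pow_mul, pow_succ', hmul, pow_mul]
    simp
  rw [hγ, Odd.neg_one_pow ⟨m, rfl⟩] at h2
  have h3 : (2 : AlgebraicClosure (ZMod p)) = 0 := by linear_combination -h2
  have h4 : ((2 : ℕ) : AlgebraicClosure (ZMod p)) = 0 := by exact_mod_cast h3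
  rw [CharP.cast_eq_zero_iff _ p] at h4
  exact hp2 ((Nat.prime_dvd_prime_iff_eq Fact.out Nat.prime_two).1 h4)

theorem mul_powerMoment_one (hp2 : p ≠ 2) (hb : ¬ IsSquare (b ^ 2 + 4)) :
    (b ^ 2 + 4) * powerMoment b 1 = b := by
  obtain ⟨α, hα, hsum, hmul, hinv⟩ := exists_conjugate_roots hp2 b hb
  apply (algebraMap (ZMod p) (AlgebraicClosure (ZMod p))).injective
  rw [powerMoment_formula b hα hsum hmul hinv (Fact.out : p.Prime).one_lt]
  linear_combination -hsum

theorem mul_powerMoment_middle_sq (hp : p % 4 = 1) (hb : ¬ IsSquare (b ^ 2 + 4)) :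
    ((b ^ 2 + 4) * powerMoment b ((p + 1) / 2)) ^ 2 = -4 := by
  have hp2 : p ≠ 2 := by omega
  obtain ⟨α, hα, hsum, hmul, hinv⟩ := exists_conjugate_roots hp2 b hb
  apply (algebraMap (ZMod p) (AlgebraicClosure (ZMod p))).injective
  rw [map_pow, powerMoment_formula b hα hsum hmul hinv
    (by have := (Fact.out : p.Prime).one_lt; omega)]
  obtain ⟨m, hm⟩ : ∃ m, p = 4 * m + 1 := ⟨p / 4, by omega⟩
  set n := (p + 1) / 2 with hn
  have hnm : n = 2 * m + 1 := by omega
  have h2n : n * 2 = p + 1 := by omega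
  have e1 : (α ^ n) ^ 2 = -1 := by rw [← pow_mul, h2n, pow_succ', hmul]
  have e2 : ((α ^ p) ^ n) ^ 2 = -1 := by rw [← pow_mul, h2n, pow_succ, hinv, hmul]
  have e3 : α ^ n * (α ^ p) ^ n = -1 := by
    rw [← mul_pow, hmul, hnm, Odd.neg_one_pow ⟨m, rfl⟩]
  simp only [map_neg, map_ofNat]
  linear_combination e1 + e2 + 2 * e3

theorem quadraticChar_powerMoment_middle (hp : p % 4 = 1) (hb : ¬ IsSquare (b ^ 2 + 4)) :
    quadraticChar (ZMod p) ((b ^ 2 + 4) * powerMoment b ((p + 1) / 2)) = 1 := by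
  have hsq := mul_powerMoment_middle_sq hp hb
  set w := (b ^ 2 + 4) * powerMoment b ((p + 1) / 2) with hw
  have hδ : b ^ 2 + 4 ≠ 0 := fun h => hb (h ▸ IsSquare.zero)
  have hw0 : w ≠ 0 := mul_ne_zero hδ (powerMoment_ne_zero hp hb
    (by have := (Fact.out : p.Prime).one_lt; omega))
  have h2 : (2 : ZMod p) ≠ 0 := by
    intro h
    apply hw0
    apply pow_eq_zero_iff (n := 2) (by norm_num) |>.1
    rw [hsq]
    linear_combination (-2) * h
  rw [quadraticChar_one_iff_isSquare hw0]
  -- Since `w ^ 2 = -4`, `(1 + w / 2) ^ 2 = w`.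
  refine ⟨1 + w / 2, ?_⟩
  field_simp
  linear_combination -hsq

theorem quadraticChar_prod_powerMoment (hp : p % 4 = 1) (hb : ¬ IsSquare (b ^ 2 + 4)) :
    quadraticChar (ZMod p) (∏ k : Fin (p - 1), powerMoment b ((k : ℕ) + 1)) =
      quadraticChar (ZMod p) b := by
  have hp1 := (Fact.out : p.Prime).one_lt
  have hp2 : p ≠ 2 := by omega
  set χ := quadraticChar (ZMod p) with hχ
  have hneg : χ (-1) = 1 := by
    rw [hχ, quadraticChar_one_iff_isSquare (by simp), ZMod.exists_sq_eq_neg_one_iff]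
    omega
  set n := (p + 1) / 2 with hn
  have hδχ : χ (b ^ 2 + 4) = -1 := quadraticChar_neg_one_iff_not_isSquare.2 hb
  have e0 : ∏ k : Fin (p - 1), powerMoment b ((k : ℕ) + 1) =
      ∏ k ∈ Finset.Ico 1 p, powerMoment b k := by
    rw [Fin.prod_univ_eq_prod_range (fun k => powerMoment b (k + 1)), Finset.prod_Ico_eq_prod_range]
    exact Finset.prod_congr rfl fun k _ => by rw [add_comm]
  -- The pairing `k ↦ p + 1 - k` fixes only `n`, and would send `1` out of range.
  have e1 : ∏ k ∈ (Finset.Ico 2 p).erase n, χ (powerMoment b k) = 1 := by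
    refine Finset.prod_involution (fun k _ => p + 1 - k) ?_ ?_ ?_ ?_
    · intro k hk
      simp only [Finset.mem_erase, Finset.mem_Ico] at hk
      have h := quadraticChar_sq_one (powerMoment_ne_zero hp hb hk.2.2)
      rw [powerMoment_reflect hp2 hb hk.2.1 hk.2.2, map_mul, map_pow, hneg, one_pow, one_mul,
        ← sq, h]
    · intro k hk _
      simp only [Finset.mem_erase, Finset.mem_Ico] at hk
      omega
    · intro k hk
      simp only [Finset.mem_erase, Finset.mem_Ico] at hk ⊢
      omega
    · intro k hk
      simp only [Finset.mem_erase, Finset.mem_Ico] at hk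
      omega
  rw [e0, Finset.prod_eq_prod_Ico_succ_bot hp1, map_mul, map_prod,
    ← Finset.mul_prod_erase (Finset.Ico 2 p) _ (Finset.mem_Ico.2 ⟨by omega, by omega⟩ :
      n ∈ Finset.Ico 2 p), e1]
  have h1 := congrArg χ (mul_powerMoment_one hp2 hb)
  have h2 := quadraticChar_powerMoment_middle hp hb
  rw [← hχ] at h2
  rw [map_mul, hδχ] at h1 h2
  rw [← h1, show χ (powerMoment b n) = -1 by linear_combination -h2]
  ring

end Legendre

theorem corollary1p1 (p : ℕ) [Fact p.Prime] (hp : p ≡ 1 [MOD 4]) (b : ℤ)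
    (hb : legendreSym p (b ^ 2 + 4) = -1) :
    legendreSym p (sunDet p b (-1)) = legendreSym p b := by
  have hp4 : p % 4 = 1 := hp
  have hp1 := (Fact.out : p.Prime).one_lt
  have hb' : ¬ IsSquare ((b : ZMod p) ^ 2 + 4) := by
    rw [legendreSym.eq_neg_one_iff] at hb
    simpa using hb
  have hnz : ∀ x y : ZMod p, y ≠ 0 → x ^ 2 + b * x * y - y ^ 2 ≠ 0 := by
    intro x y hy h
    apply hb'
    -- Completing the square: a zero makes the discriminant a square.
    refine ⟨2 * (x / y) + b, ?_⟩
    field_simp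
    linear_combination -4 * h
  have hdet : ((sunDet p b (-1) : ℤ) : ZMod p) =
      (∏ k : Fin (p - 1), powerMoment (b : ZMod p) ((k : ℕ) + 1)) *
        (∏ j : Fin (p - 1), (((j : ℕ) : ZMod p) + 1)⁻¹) ^ 2 := by
    rw [← det_inv_quadratic_form, sunDet]
    refine (RingHom.map_det (Int.castRingHom (ZMod p)) _).trans ?_
    congr 1
    ext i j
    simp only [RingHom.mapMatrix_apply, Matrix.map_apply, Matrix.of_apply, Int.coe_castRingHom]
    push_cast
    have h := hnz (((i : ℕ) : ZMod p) + 1) _ (natCast_fin_succ_ne_zero j)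
    rw [neg_one_mul, ← sub_eq_add_neg]
    apply mul_right_cancel₀ h
    rw [inv_mul_cancel₀ h, ← pow_succ, show p - 2 + 1 = p - 1 by omega]
    exact ZMod.pow_card_sub_one_eq_one h
  rw [legendreSym, legendreSym, hdet, map_mul, map_pow, quadraticChar_sq_one, mul_one,
    quadraticChar_prod_powerMoment hp4 hb']
  exact Finset.prod_ne_zero_iff.2 fun j _ => inv_ne_zero (natCast_fin_succ_ne_zero j)
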